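/- Let $\mathcal P$ be a stationary stochastic process in discrete time with outputs $X_t$ ($t\in\mathbb Z$) in a countable non-empty alphabet; that is, $P(X_{t:t+L})=P(X_{0:L})$ for all $t\in\mathbb Z$ and $L\ge 0$, where $X_{t:t+L}=(X_t,\dots,X_{t+L-1})$. Write $\overleftarrow X=\dots X_{-2}X_{-1}$ for the past and $\overrightarrow X=X_0X_1\dots$ for the future. Two pasts are equivalent if they have the same conditional future $P(\overrightarrow X\mid\overleftarrow X=\overleftarrow x)$; the equivalence classes are the causal states. The classical topological complexity $D_\mu$ is the logarithm of the number of causal states, counted up to sets of pasts of probability zero (i.e. the least number of causal states met on a set of pasts of probability one), and $D_\mu=\infty$ if this number is infinite. A quantum model of $\mathcal P$ on a $d$-dimensional system consists of a (measurable) encoding $f$ of pasts into unit vectors of $\mathbb C^d$ and a quantum instrument $(M_x)_x$ (completely positive maps on the operators on $\mathbb C^d$ whose sum over the outputs $x$ preserves the trace) such that, for almost every past $\overleftarrow x$, when the system is prepared in the state $f(\overleftarrow x)$ the instrument (i) emits $x$ with probability $P(X_0=x\mid\overleftarrow X=\overleftarrow x)$, for every $x$, and (ii) upon emitting $x$ with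 positive probability, leaves the system in the state $f(\overleftarrow x x)$, where $\overleftarrow x x$ is the past $\overleftarrow x$ followed by $x$. The quantum topological complexity $D_q$ is the logarithm of the least $d$ for which $\mathcal P$ has such a model ($\infty$ if there is none). Let $D_\mu^+, D_q^+$ be these quantities for $\mathcal P$, and $D_\mu^-, D_q^-$ the same quantities for the time-reversed process $Y_t=X_{-(t+1)}$. Then $$\max(D_q^+,D_q^-)\le\min(D_\mu^+,D_\mu^-)\quad\text{in } [0,\infty].$$ -/

import Mathlib

open MeasureTheory ProbabilityTheory
open scoped CStarAlgebra

noncomputable section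

namespace CausalAsymmetry

/-! ### Stochastic processes

A discrete-time process with outputs in the countable alphabet `α` is given by its law, a probability
measure on the space `ℤ → α` of bi-infinite output strings. A one-sided infinite string
`ℕ → α` is used both for pasts (entry `n` is the output at time `-(n+1)`, most recent first)
and for futures (entry `n` is the output at time `n`). -/

section Classical

variable {α : Type*}

/-- The past `… x₋₂ x₋₁` of a bi-infinite string. -/
def past (ω : ℤ → α) : ℕ → α := fun n => ω (-((n : ℤ) + 1))

/-- The future `x₀ x₁ …` of a bi-infinite string. -/
def future (ω : ℤ → α) : ℕ → α := fun n => ω (n : ℤ)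

/-- The block `x_t x_{t+1} … x_{t+L-1}`. -/
def block (t : ℤ) (L : ℕ) (ω : ℤ → α) : Fin L → α := fun i => ω (t + (i : ℕ))

/-- The past `p x`, obtained from the past `p` when `x` is emitted next. -/
def extend (p : ℕ → α) (x : α) : ℕ → α
  | 0 => x
  | n + 1 => p n

/-- The time-reversed string `y_t = x_{-(t+1)}`. -/
def reverse (ω : ℤ → α) : ℤ → α := fun t => ω (-(t + 1))

variable [MeasurableSpace α]

/-- Stationarity: `P(X_{0:L}) = P(X_{t:t+L})` for all `t` and `L`. -/
def IsStationary (P : Measure (ℤ → α)) : Prop :=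
  ∀ (t : ℤ) (L : ℕ), P.map (block t L) = P.map (block 0 L)

/-- The law of the time-reversed process. -/
def timeReversal (P : Measure (ℤ → α)) : Measure (ℤ → α) := P.map reverse

instance (P : Measure (ℤ → α)) [IsFiniteMeasure P] : IsFiniteMeasure (timeReversal P) := by
  unfold timeReversal; infer_instance

/-- The law of the past. -/
def pastLaw (P : Measure (ℤ → α)) : Measure (ℕ → α) := P.map past

variable [Nonempty α] [Countable α] [MeasurableSingletonClass α]

/-- The conditional law `P(future | past = p)` of the future given the past (a regular conditional
distribution; it is determined by `P` for almost every past). -/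
def conditionalFuture (P : Measure (ℤ → α)) [IsFiniteMeasure P] : Kernel (ℕ → α) (ℕ → α) :=
  condDistrib future past P

/-- The probability `P(X₀ = x | past = p)` of the next output. -/
def outputProb (P : Measure (ℤ → α)) [IsFiniteMeasure P] (p : ℕ → α) (x : α) : ℝ :=
  (conditionalFuture P p).real {y | y 0 = x}

/-! ### Causal states -/

/-- Two pasts are equivalent when they have the same conditional future. -/
def causalSetoid (P : Measure (ℤ → α)) [IsFiniteMeasure P] : Setoid (ℕ → α) where
  r p p' := conditionalFuture P p = conditionalFuture P p'
  iseqv := ⟨fun _ => rfl, fun h => h.symm, fun h h' => h.trans h'⟩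

/-- The encoding function of the ε-machine: it sends a past to its causal state (its equivalence
class). -/
def causalState (P : Measure (ℤ → α)) [IsFiniteMeasure P] (p : ℕ → α) :
    Quotient (causalSetoid P) :=
  Quotient.mk (causalSetoid P) p

/-- The number of causal states, in `ℕ∞`. Since conditional futures are determined up to a null
set of pasts only, it is the least number of causal states that are met on a set of pasts of full
probability. If it is finite it is the number of causal states of positive probability. -/
def numCausalStates (P : Measure (ℤ → α)) [IsFiniteMeasure P] : ℕ∞ :=
  ⨅ (A : Set (ℕ → α)) (_ : A ∈ ae (pastLaw P)), (causalState P '' A).encard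

/-- The classical topological state complexity `D_μ`: the logarithm of the number of causal states
(`⊤` if there are infinitely many). -/
def classicalTopologicalComplexity (P : Measure (ℤ → α)) [IsFiniteMeasure P] : EReal :=
  ENNReal.log (numCausalStates P : ENNReal)

end Classical

/-! ### Quantum models -/

/-- The state space of a `d`-level quantum system. -/
abbrev Qudit (d : ℕ) : Type := EuclideanSpace ℂ (Fin d)

/-- The operators on a `d`-level quantum system, a C⋆-algebra with its Loewner order. -/
abbrev Op (d : ℕ) : Type := Qudit d →L[ℂ] Qudit d

/-- The trace of an operator. -/
def trace {d : ℕ} (A : Op d) : ℂ := LinearMap.trace ℂ (Qudit d) A.toLinearMap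

/-- The operator `|v⟩⟨v|`. -/
def ketbra {d : ℕ} (v : Qudit d) : Op d := InnerProductSpace.rankOne ℂ v v

/-- A quantum process with classical outputs in `α` acting on a `d`-level system, i.e. a quantum
instrument: on the input `ρ` it emits `x` with probability `trace (op x ρ)` and leaves the system
in the state proportional to `op x ρ`. Each `op x` is completely positive, and the probabilities of
all outputs add up to one, i.e. `∑ₓ op x` preserves the trace. -/
structure QuantumInstrument (α : Type*) (d : ℕ) where
  op : α → (Op d →CP Op d)
  hasSum_trace : ∀ ρ : Op d, HasSum (fun x => trace (op x ρ)) (trace ρ)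

section Model

variable {α : Type*} [MeasurableSpace α] [Nonempty α] [Countable α] [MeasurableSingletonClass α]

/-- A quantum causal model, on a `d`-level system, of the process with law `P`: an
encoding function `f` of pasts into pure states (unit vectors), and one quantum process `M`
such that for almost every past `p`, when the system is prepared in `f p`, the action of `M` emits
`x` with probability `P(X₀ = x | past = p)` and then leaves the system in the state `f (p x)`.
The set of internal states is the range of `f`. -/
structure QuantumModel (P : Measure (ℤ → α)) [IsFiniteMeasure P] (d : ℕ) where
  f : (ℕ → α) → Qudit d
  measurable_f : Measurable f
  norm_f : ∀ p, ‖f p‖ = 1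
  M : QuantumInstrument α d
  output : ∀ᵐ p ∂(pastLaw P), ∀ x, trace (M.op x (ketbra (f p))) = (outputProb P p x : ℂ)
  transition : ∀ᵐ p ∂(pastLaw P), ∀ x, outputProb P p x ≠ 0 →
    ((outputProb P p x : ℂ)⁻¹) • M.op x (ketbra (f p)) = ketbra (f (extend p x))

/-- The least dimension of a quantum system that carries a quantum model of the process, in `ℕ∞`
(`⊤` if there is no quantum model on a finite-dimensional system). -/
def minQuantumDim (P : Measure (ℤ → α)) [IsFiniteMeasure P] : ℕ∞ :=
  ⨅ (d : ℕ) (_ : Nonempty (QuantumModel P d)), (d : ℕ∞)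

/-- The quantum topological state complexity `D_q`: the logarithm of the least dimension of a
quantum model. -/
def quantumTopologicalComplexity (P : Measure (ℤ → α)) [IsFiniteMeasure P] : EReal :=
  ENNReal.log (minQuantumDim P : ENNReal)

end Model

end CausalAsymmetry

end

/-! Time reversal is an involution preserving stationarity, so it suffices to bound both quantum
dimensions by the number of causal states of `P` (`minQuantumDim_le_numCausalStates`). If almost all
pasts lie in finitely many causal states, keep the `d` states of positive probability
(`exists_stateEncoding`). Write `S₀` for the state of the past at time 0 and `S₋₁` for the state one
step earlier.

Forward, the ε-machine itself, with its states as an orthonormal basis, is a quantum model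
(`nonempty_quantumModel`).

Backward, encode a future `y` by the vector with coordinates `√P(S₀ = i | y)`. By unifilarity
(`exists_successor`), `S₋₁ = j` and `X₋₁ = x` fix `S₀ = next j x`, and the future depends on them
only through `S₀`. Hence `P(X₋₁ = x, S₋₁ = j | y) = w j x * P(S₀ = next j x | y)`, where `w j x`
does not depend on `y` (`ae_reverse_state`). The chain rule writes the left side as `P(X₋₁ = x | y)
* P(S₋₁ = j | x y)` (`ae_conditionalFuture_extend` for the reversed process). Neither side is a sum,
so square roots may be taken: the operator `∑ⱼ √(w j x) |j⟩⟨next j x|` sends the vector of `y` to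
`√P(x | y)` times the vector of `x y`. These operators, one for each output, form an instrument
because the rates `w` leading into each state sum to one (`tsum_reverseRate`). -/

namespace CausalAsymmetry

/-! ### Instruments from Kraus operators. -/

section Quantum

variable {d : ℕ} {ι : Type*} [Fintype ι]

/-- The linear map `ρ ↦ ∑ₐ Kₐ ρ Kₐ†`. -/
noncomputable def krausLinearMap (K : ι → Op d) : Op d →ₗ[ℂ] Op d :=
  ∑ a, LinearMap.mulLeftRight ℂ (K a, star (K a))

lemma krausLinearMap_apply (K : ι → Op d) (ρ : Op d) :
    krausLinearMap K ρ = ∑ a, K a * ρ * star (K a) := by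
  simp [krausLinearMap, LinearMap.sum_apply]

/-- The completely positive map `ρ ↦ ∑ₐ Kₐ ρ Kₐ†` with Kraus operators `Kₐ`. -/
noncomputable def krausMap (K : ι → Op d) : Op d →CP Op d where
  toLinearMap := krausLinearMap K
  map_cstarMatrix_nonneg' k M hM := by
    classical
    let D : ι → CStarMatrix (Fin k) (Fin k) (Op d) :=
      fun a => CStarMatrix.ofMatrix (Matrix.diagonal fun _ => K a)
    -- Applied entrywise to matrices, the map is a sum of conjugations by block-diagonal matrices,
    -- which preserve positivity.
    have h : M.map (krausLinearMap K) = ∑ a, D a * M * star (D a) := by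
      have hsum : ∀ (F : ι → CStarMatrix (Fin k) (Fin k) (Op d)) (i j : Fin k),
          (∑ a, F a) i j = ∑ a, F a i j := fun F i j => by
        induction (Finset.univ : Finset ι) using Finset.induction_on with
        | empty => simp
        | insert a t ha ih => simp [Finset.sum_insert ha, ih]
      have hD : ∀ a i j, D a i j = if i = j then K a else 0 := fun a i j =>
        Matrix.diagonal_apply ..
      refine CStarMatrix.ext fun i j => ?_
      rw [hsum, CStarMatrix.map_apply, krausLinearMap_apply]
      refine Finset.sum_congr rfl fun a _ => ?_
      simp only [CStarMatrix.mul_apply, CStarMatrix.star_apply, hD, ite_mul, zero_mul,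
        Finset.sum_ite_eq, Finset.mem_univ, if_true]
      rw [Finset.sum_eq_single j]
      · simp
      · intro b _ hb
        rw [if_neg hb.symm]
        exact (congrArg _ (star_zero (Op d))).trans (mul_zero _)
      · simp
    change 0 ≤ M.map (krausLinearMap K)
    rw [h]
    exact Finset.sum_nonneg fun a _ => star_right_conjugate_nonneg hM (D a)

lemma krausMap_apply (K : ι → Op d) (ρ : Op d) :
    krausMap K ρ = ∑ a, K a * ρ * star (K a) :=
  krausLinearMap_apply K ρ

lemma mul_ketbra_mul_star (K : Op d) (v : Qudit d) : K * ketbra v * star K = ketbra (K v) := by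
  unfold ketbra
  rw [ContinuousLinearMap.mul_def, ContinuousLinearMap.mul_def,
    ContinuousLinearMap.star_eq_adjoint, InnerProductSpace.comp_rankOne,
    InnerProductSpace.rankOne_comp, ContinuousLinearMap.adjoint_adjoint]

lemma ketbra_smul (c : ℝ) (v : Qudit d) : ketbra ((c : ℂ) • v) = ((c ^ 2 : ℝ) : ℂ) • ketbra v := by
  ext u : 1
  change inner ℂ ((c : ℂ) • v) u • ((c : ℂ) • v) = ((c ^ 2 : ℝ) : ℂ) • inner ℂ v u • v
  rw [inner_smul_left, smul_smul, smul_smul, Complex.conj_ofReal]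
  congr 1
  push_cast
  ring

lemma trace_ketbra (v : Qudit d) : trace (ketbra v) = ((‖v‖ ^ 2 : ℝ) : ℂ) := by
  unfold trace ketbra
  rw [InnerProductSpace.trace_rankOne, inner_self_eq_norm_sq_to_K]
  simp

lemma trace_krausMap (K : ι → Op d) (ρ : Op d) :
    trace (krausMap K ρ) = trace ((∑ a, star (K a) * K a) * ρ) := by
  rw [krausMap_apply, Finset.sum_mul]
  unfold trace
  simp only [ContinuousLinearMap.toLinearMap_sum, map_sum]
  refine Finset.sum_congr rfl fun a _ => ?_
  rw [mul_assoc (star (K a)), ContinuousLinearMap.toLinearMap_mul,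
    ContinuousLinearMap.toLinearMap_mul (star (K a)), LinearMap.trace_mul_comm]

/-- The standard basis vector `|i⟩`. -/
noncomputable def ket (i : Fin d) : Qudit d := EuclideanSpace.single i 1

lemma trace_ketbra_ket_mul (i : Fin d) (ρ : Op d) :
    trace (ketbra (ket i) * ρ) = inner ℂ (ket i) (ρ (ket i)) := by
  unfold trace ketbra
  rw [ContinuousLinearMap.toLinearMap_mul, LinearMap.trace_mul_comm,
    ← ContinuousLinearMap.toLinearMap_mul, ContinuousLinearMap.mul_def,
    InnerProductSpace.comp_rankOne, InnerProductSpace.trace_rankOne]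

lemma trace_eq_sum_inner_ket (ρ : Op d) : trace ρ = ∑ i, inner ℂ (ket i) (ρ (ket i)) := by
  unfold trace
  rw [LinearMap.trace_eq_sum_inner _ (EuclideanSpace.basisFun (Fin d) ℂ)]
  simp [ket]

/-- The quantum instrument with Kraus operators `K x a` whose effects
`∑ₐ (K x a)† (K x a)` are diagonal in the standard basis. -/
noncomputable def instrumentOfKraus {α : Type*} (K : α → ι → Op d) (w : Fin d → α → ℝ)
    (m : Fin d → α → Fin d)
    (hK : ∀ x, ∑ a, star (K x a) * K x a = ∑ j, (w j x : ℂ) • ketbra (ket (m j x)))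
    (hw : ∀ i, HasSum (fun x => ∑ j, if m j x = i then w j x else 0) 1) :
    QuantumInstrument α d where
  op x := krausMap (K x)
  hasSum_trace ρ := by
    -- Diagonal effects see only the diagonal entries of `ρ`, so trace preservation reduces to `hw`.
    have h : ∀ x, trace (krausMap (K x) ρ) =
        ∑ i, ((∑ j, if m j x = i then w j x else 0 : ℝ) : ℂ) *
          inner ℂ (ket i) (ρ (ket i)) := by
      intro x
      rw [trace_krausMap, hK, Finset.sum_mul]
      have : ∀ j, trace (((w j x : ℂ) • ketbra (ket (m j x))) * ρ) =
          (w j x : ℂ) * inner ℂ (ket (m j x)) (ρ (ket (m j x))) := by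
        intro j
        rw [← trace_ketbra_ket_mul, smul_mul_assoc]
        simp [trace]
      have h2 : trace (∑ j, ((w j x : ℂ) • ketbra (ket (m j x))) * ρ) =
          ∑ j, trace (((w j x : ℂ) • ketbra (ket (m j x))) * ρ) := by
        simp [trace]
      rw [h2]
      simp_rw [this, Complex.ofReal_sum, Finset.sum_mul]
      rw [Finset.sum_comm]
      refine Finset.sum_congr rfl fun j _ => ?_
      rw [Finset.sum_eq_single (m j x)]
      · simp
      · intro b _ hb
        simp [hb.symm]
      · simp
    simp_rw [h]
    rw [trace_eq_sum_inner_ket]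
    refine hasSum_sum fun i _ => ?_
    simpa using ((Complex.hasSum_ofReal.2 (hw i)).mul_right (inner ℂ (ket i) (ρ (ket i))))

end Quantum

/-! ### Shift, reversal and stationarity. -/

section Strings

variable {α : Type*}

/-- The shift `x ↦ (x_{t+1})_t` of bi-infinite strings. -/
def shift (ω : ℤ → α) : ℤ → α := fun t => ω (t + 1)

/-- A one-sided string without its first entry. -/
def tail (y : ℕ → α) : ℕ → α := fun n => y (n + 1)

lemma tail_extend (p : ℕ → α) (x : α) : tail (extend p x) = p := rfl

lemma past_shift (ω : ℤ → α) : past (shift ω) = extend (past ω) (ω 0) := by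
  funext n
  cases n with
  | zero => simp [past, shift, extend]
  | succ n => simp [past, shift, extend]

lemma future_shift (ω : ℤ → α) : future (shift ω) = tail (future ω) := by
  funext n
  simp [future, shift, tail]

lemma past_reverse (ω : ℤ → α) : past (reverse ω) = future ω := by
  funext n
  simp [past, reverse, future]

lemma future_reverse (ω : ℤ → α) : future (reverse ω) = past ω := rfl

lemma reverse_reverse (ω : ℤ → α) : reverse (reverse ω) = ω := by
  funext n
  simp [reverse]

variable [MeasurableSpace α]

lemma measurable_past : Measurable (past : (ℤ → α) → ℕ → α) :=
  measurable_pi_lambda _ fun _ => measurable_pi_apply _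

lemma measurable_future : Measurable (future : (ℤ → α) → ℕ → α) :=
  measurable_pi_lambda _ fun _ => measurable_pi_apply _

lemma measurable_block (t : ℤ) (L : ℕ) : Measurable (block t L : (ℤ → α) → Fin L → α) :=
  measurable_pi_lambda _ fun _ => measurable_pi_apply _

lemma measurable_reverse : Measurable (reverse : (ℤ → α) → ℤ → α) :=
  measurable_pi_lambda _ fun _ => measurable_pi_apply _

lemma measurable_shift : Measurable (shift : (ℤ → α) → ℤ → α) :=
  measurable_pi_lambda _ fun _ => measurable_pi_apply _

lemma measurable_tail : Measurable (tail : (ℕ → α) → ℕ → α) :=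
  measurable_pi_lambda _ fun _ => measurable_pi_apply _

lemma measurable_extend (x : α) : Measurable (fun p : ℕ → α => extend p x) := by
  refine measurable_pi_lambda _ fun n => ?_
  cases n with
  | zero => exact measurable_const
  | succ n => exact measurable_pi_apply n

lemma timeReversal_timeReversal (P : Measure (ℤ → α)) : timeReversal (timeReversal P) = P := by
  unfold timeReversal
  rw [Measure.map_map measurable_reverse measurable_reverse]
  have : (reverse ∘ reverse : (ℤ → α) → ℤ → α) = id := funext reverse_reverse
  rw [this, Measure.map_id]

instance (P : Measure (ℤ → α)) [IsProbabilityMeasure P] :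
    IsProbabilityMeasure (timeReversal P) :=
  Measure.isProbabilityMeasure_map measurable_reverse.aemeasurable

instance (P : Measure (ℤ → α)) [IsProbabilityMeasure P] : IsProbabilityMeasure (pastLaw P) :=
  Measure.isProbabilityMeasure_map measurable_past.aemeasurable

instance (P : Measure (ℤ → α)) [IsFiniteMeasure P] : IsFiniteMeasure (pastLaw P) := by
  unfold pastLaw; infer_instance

lemma IsStationary.timeReversal {P : Measure (ℤ → α)} (hP : IsStationary P) :
    IsStationary (timeReversal P) := by
  have h : ∀ (t : ℤ) (L : ℕ), (CausalAsymmetry.timeReversal P).map (block t L) =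
      (P.map (block 0 L)).map (fun b => b ∘ Fin.rev) := by
    intro t L
    have hrev : Measurable (fun b : Fin L → α => b ∘ Fin.rev) :=
      measurable_pi_lambda _ fun _ => measurable_pi_apply _
    -- Reversal carries the times `t, …, t+L-1` to `-(t+1), …, -(t+L)`, a window starting at
    -- `-(t+L)`.
    rw [← hP (-(t + L)) L, CausalAsymmetry.timeReversal,
      Measure.map_map (measurable_block _ _) measurable_reverse,
      Measure.map_map hrev (measurable_block _ _)]
    congr 1
    funext ω i
    simp only [Function.comp_apply, block, reverse, Fin.val_rev]
    congr 1
    have := i.isLt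
    omega
  intro t L
  rw [h, h]

/-- A finite measure on strings is determined by its finite marginals, and every finite set of times
lies in one window, where block stationarity applies. -/
lemma IsStationary.map_shift {P : Measure (ℤ → α)} [IsFiniteMeasure P] (hP : IsStationary P) :
    P.map shift = P := by
  refine IsProjectiveLimit.unique (P := fun I => P.map I.restrict) (fun I => ?_) (fun I => rfl)
  obtain ⟨t, L, h⟩ : ∃ (t : ℤ) (L : ℕ), ∀ i ∈ I, ∃ k : Fin L, i = t + (k : ℕ) := by
    obtain ⟨a, ha⟩ := I.bddBelow
    obtain ⟨b, hb⟩ := I.bddAbove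
    refine ⟨a, (b - a + 1).toNat, fun i hi => ⟨⟨(i - a).toNat, ?_⟩, ?_⟩⟩
    · have := ha hi; have := hb hi; omega
    · have := ha hi; simp; omega
  choose k hk using h
  let g : (Fin L → α) → (I → α) := fun b i => b (k i i.2)
  have hg : Measurable g := measurable_pi_lambda _ fun _ => measurable_pi_apply _
  have h1 : (I.restrict : (ℤ → α) → I → α) = g ∘ block t L := by
    funext ω i
    simp only [Finset.restrict, Function.comp_apply, g, block]
    rw [← hk]
  have h2 : (I.restrict ∘ shift : (ℤ → α) → I → α) = g ∘ block (t + 1) L := by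
    funext ω i
    simp only [Finset.restrict, Function.comp_apply, g, block, shift]
    congr 1
    have := hk i i.2
    omega
  have hm : Measurable (I.restrict : (ℤ → α) → I → α) := by
    rw [h1]; exact hg.comp (measurable_block _ _)
  change (P.map shift).map I.restrict = P.map I.restrict
  rw [Measure.map_map hm measurable_shift, h2, h1, ← Measure.map_map hg (measurable_block _ _),
    ← Measure.map_map hg (measurable_block _ _), hP (t + 1), hP t]

lemma IsStationary.measure_preimage_shift {P : Measure (ℤ → α)} [IsFiniteMeasure P]
    (hP : IsStationary P) {S : Set (ℤ → α)} (hS : MeasurableSet S) : P (shift ⁻¹' S) = P S := by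
  rw [← Measure.map_apply measurable_shift hS, hP.map_shift]

lemma measurableSet_head_eq [MeasurableSingletonClass α] (x : α) :
    MeasurableSet {y : ℕ → α | y 0 = x} :=
  (measurable_pi_apply (X := fun _ : ℕ => α) 0) (measurableSet_singleton x)

end Strings

/-! ### Conditional futures after one more output. -/

section ConditionalFuture

variable {α : Type*} [MeasurableSpace α] [Nonempty α] [Countable α] [MeasurableSingletonClass α]

instance (P : Measure (ℤ → α)) [IsFiniteMeasure P] : IsMarkovKernel (conditionalFuture P) := by
  unfold conditionalFuture; infer_instance

lemma setLIntegral_conditionalFuture (P : Measure (ℤ → α)) [IsFiniteMeasure P]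
    {D B : Set (ℕ → α)} (hD : MeasurableSet D) (hB : MeasurableSet B) :
    ∫⁻ p in D, conditionalFuture P p B ∂(pastLaw P) = P {ω | past ω ∈ D ∧ future ω ∈ B} := by
  rw [pastLaw, setLIntegral_map hD (Kernel.measurable_coe _ hB) measurable_past]
  exact setLIntegral_preimage_condDistrib measurable_past measurable_future.aemeasurable hB hD

/-- The law of the past extended by the next output is the law of the past. -/
lemma lintegral_head_mul_extend {P : Measure (ℤ → α)} [IsFiniteMeasure P] (hP : IsStationary P)
    (x : α) {g : (ℕ → α) → ENNReal} (hg : Measurable g) :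
    ∫⁻ p, conditionalFuture P p {y | y 0 = x} * g (extend p x) ∂(pastLaw P) =
      ∫⁻ p in {p | p 0 = x}, g p ∂(pastLaw P) := by
  have hx := measurableSet_head_eq x
  have hgx : Measurable (fun p => g (extend p x)) := hg.comp (measurable_extend x)
  have hind : Measurable ({y : ℕ → α | y 0 = x}.indicator (1 : (ℕ → α) → ENNReal)) :=
    measurable_one.indicator hx
  have h1 : ∀ p, conditionalFuture P p {y | y 0 = x} * g (extend p x) =
      ∫⁻ y, {y : ℕ → α | y 0 = x}.indicator 1 y * g (extend p x) ∂(conditionalFuture P p) := by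
    intro p
    rw [lintegral_mul_const _ hind, lintegral_indicator_one hx]
  have hF : Measurable (fun q : (ℕ → α) × (ℕ → α) =>
      {y : ℕ → α | y 0 = x}.indicator 1 q.2 * g (extend q.1 x)) :=
    (hind.comp measurable_snd).mul (hgx.comp measurable_fst)
  simp_rw [h1]
  rw [← Measure.lintegral_compProd (μ := pastLaw P) (κ := conditionalFuture P) hF, pastLaw,
    conditionalFuture, compProd_map_condDistrib measurable_future.aemeasurable,
    lintegral_map hF (measurable_past.prodMk measurable_future),
    setLIntegral_map hx hg measurable_past,
    ← lintegral_indicator (measurable_past hx)]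
  have hgp : Measurable ((past ⁻¹' {y : ℕ → α | y 0 = x}).indicator
      fun ω : ℤ → α => g (past ω)) :=
    (hg.comp measurable_past).indicator (measurable_past hx)
  -- Shifting only the right side turns its past into the past extended by the output at time 0.
  conv_rhs => rw [← hP.map_shift, lintegral_map hgp measurable_shift]
  refine lintegral_congr fun ω => ?_
  by_cases h : ω 0 = x
  · have h2 : past (shift ω) 0 = x := by rw [past_shift]; exact h
    have h3 : future ω 0 = x := h
    simp [Set.indicator, h2, h3, past_shift, h]
  · have h2 : past (shift ω) 0 ≠ x := by rw [past_shift]; exact h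
    have h3 : future ω 0 ≠ x := h
    simp [Set.indicator, h2, h3]

/-- Almost surely, a past extended by an output of positive probability avoids a null set. -/
lemma ae_extend {P : Measure (ℤ → α)} [IsFiniteMeasure P] (hP : IsStationary P)
    {q : (ℕ → α) → Prop} (hq : ∀ᵐ p ∂(pastLaw P), q p) :
    ∀ᵐ p ∂(pastLaw P), ∀ x, conditionalFuture P p {y | y 0 = x} ≠ 0 → q (extend p x) := by
  refine ae_all_iff.2 fun x => ?_
  -- `q` need not be measurable, so its exceptional set is replaced by a measurable null hull.
  let N := toMeasurable (pastLaw P) {p | ¬ q p}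
  have hN : MeasurableSet N := measurableSet_toMeasurable _ _
  have hN0 : pastLaw P N = 0 := by rw [measure_toMeasurable]; exact hq
  have hm : Measurable (N.indicator (1 : (ℕ → α) → ENNReal)) := measurable_one.indicator hN
  have h := lintegral_head_mul_extend hP x hm
  have h0 : ∫⁻ p in {p | p 0 = x}, N.indicator 1 p ∂(pastLaw P) = 0 := by
    rw [lintegral_indicator_one hN]
    exact Measure.absolutelyContinuous_of_le Measure.restrict_le_self hN0
  have hmeas : Measurable fun p => conditionalFuture P p {y | y 0 = x} *
      N.indicator (1 : (ℕ → α) → ENNReal) (extend p x) :=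
    (Kernel.measurable_coe _ (measurableSet_head_eq x)).mul (hm.comp (measurable_extend x))
  rw [h0, lintegral_eq_zero_iff hmeas] at h
  filter_upwards [h] with p hp hne
  by_contra hqp
  have : extend p x ∈ N := subset_toMeasurable _ _ hqp
  simp [Set.indicator, this, hne] at hp

/-- The update rule of conditional futures. -/
lemma ae_conditionalFuture_extend {P : Measure (ℤ → α)} [IsFiniteMeasure P]
    (hP : IsStationary P) (x : α) {B : Set (ℕ → α)} (hB : MeasurableSet B) :
    ∀ᵐ p ∂(pastLaw P),
      conditionalFuture P p {y | y 0 = x} * conditionalFuture P (extend p x) B =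
        conditionalFuture P p {y | y 0 = x ∧ tail y ∈ B} := by
  have hx := measurableSet_head_eq x
  have hxB : MeasurableSet {y : ℕ → α | y 0 = x ∧ tail y ∈ B} := hx.inter (measurable_tail hB)
  refine ae_eq_of_forall_setLIntegral_eq_of_sigmaFinite
    ((Kernel.measurable_coe _ hx).mul ((Kernel.measurable_coe _ hB).comp (measurable_extend x)))
    (Kernel.measurable_coe _ hxB) fun D hD _ => ?_
  rw [setLIntegral_conditionalFuture P hD hxB, ← lintegral_indicator hD]
  -- Restricting to `tail ⁻¹' D` after the extension is the same as restricting to `D` before it.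
  have hg : Measurable ((tail ⁻¹' D).indicator fun p => conditionalFuture P p B) :=
    (Kernel.measurable_coe _ hB).indicator (measurable_tail hD)
  have h := lintegral_head_mul_extend hP x hg
  rw [setLIntegral_indicator (measurable_tail hD),
    setLIntegral_conditionalFuture P ((measurable_tail hD).inter hx) hB] at h
  have hset : MeasurableSet {ω : ℤ → α | past ω ∈ tail ⁻¹' D ∩ {p | p 0 = x} ∧ future ω ∈ B} :=
    (measurable_past ((measurable_tail hD).inter hx)).inter (measurable_future hB)
  rw [← hP.measure_preimage_shift hset] at h
  refine Eq.trans (lintegral_congr fun p => ?_) (h.trans ?_)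
  · by_cases hp : p ∈ D
    · simp [Set.indicator, hp, tail_extend]
    · simp [Set.indicator, hp, tail_extend]
  · congr 1
    ext ω
    simp only [Set.mem_preimage, Set.mem_ofPred_eq, past_shift, future_shift, Set.mem_inter_iff,
      tail_extend, and_assoc]
    rfl

end ConditionalFuture

/-! ### Finitely many causal states and unifilarity. -/

section States

/-- Equality of the measures can be tested on a countable generating algebra: it is a π-system
containing the whole space. -/
lemma measurableSet_setOf_kernel_eq {β γ : Type*} [MeasurableSpace β] [MeasurableSpace γ]
    [MeasurableSpace.CountablyGenerated γ] (κ : Kernel β γ) [IsFiniteKernel κ] (ν : Measure γ) :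
    MeasurableSet {b | κ b = ν} := by
  by_cases hν : ∃ b, κ b = ν
  swap
  · convert MeasurableSet.empty (α := β)
    ext b
    simpa using fun h => hν ⟨b, h⟩
  obtain ⟨b₀, rfl⟩ := hν
  let C : Set (Set γ) := generateSetAlgebra (MeasurableSpace.countableGeneratingSet γ)
  have hC : C.Countable :=
    countable_generateSetAlgebra (MeasurableSpace.countable_countableGeneratingSet (α := γ))
  have hgen : ‹MeasurableSpace γ› = MeasurableSpace.generateFrom C := by
    rw [generateFrom_generateSetAlgebra_eq,
      MeasurableSpace.generateFrom_countableGeneratingSet]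
  have halg : IsSetAlgebra C := isSetAlgebra_generateSetAlgebra
  have hmeas : ∀ B ∈ C, MeasurableSet B := fun B hB => by
    rw [hgen]; exact MeasurableSpace.measurableSet_generateFrom hB
  have : {b | κ b = κ b₀} = ⋂ B ∈ C, {b | κ b B = κ b₀ B} := by
    ext b
    simp only [Set.mem_ofPred_eq, Set.mem_iInter]
    refine ⟨fun h B _ => by rw [h], fun h => ?_⟩
    exact ext_of_generate_finite C hgen (fun s hs t ht _ => halg.inter_mem hs ht) h
      (h _ halg.univ_mem)
  rw [this]
  exact MeasurableSet.biInter hC fun B hB =>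
    Kernel.measurable_coe κ (hmeas B hB) (measurableSet_singleton _)

variable {α : Type*} [MeasurableSpace α] [Nonempty α] [Countable α] [MeasurableSingletonClass α]

/-- An encoding of the pasts of a process into `d` causal states of positive probability, the
`i`-th of which has the conditional future `law i`. -/
structure StateEncoding (P : Measure (ℤ → α)) [IsFiniteMeasure P] (d : ℕ) where
  state : (ℕ → α) → Fin d
  measurable_state : Measurable state
  law : Fin d → Measure (ℕ → α)
  law_injective : Function.Injective law
  ae_eq : ∀ᵐ p ∂(pastLaw P), conditionalFuture P p = law (state p)
  pos : ∀ i, pastLaw P (state ⁻¹' {i}) ≠ 0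

/-- If almost all pasts are in finitely many causal states, then the causal states of positive
probability encode the pasts. -/
lemma exists_stateEncoding (P : Measure (ℤ → α)) [IsProbabilityMeasure P] {A : Set (ℕ → α)}
    (hA : A ∈ ae (pastLaw P)) (hfin : (causalState P '' A).Finite) :
    ∃ d : ℕ, (d : ℕ∞) ≤ (causalState P '' A).encard ∧ Nonempty (StateEncoding P d) := by
  classical
  let κ := conditionalFuture P
  let l : Quotient (causalSetoid P) → Measure (ℕ → α) := Quotient.lift κ fun _ _ h => h
  have hF : l '' (causalState P '' A) = κ '' A := by
    rw [Set.image_image]; rfl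
  have hFfin : (κ '' A).Finite := hF ▸ hfin.image l
  let V : Finset (Measure (ℕ → α)) :=
    hFfin.toFinset.filter fun ν => pastLaw P {p | κ p = ν} ≠ 0
  have hV : ∀ᵐ p ∂(pastLaw P), κ p ∈ V := by
    have h1 : ∀ᵐ p ∂(pastLaw P), ∀ ν ∈ hFfin.toFinset, pastLaw P {p | κ p = ν} = 0 → κ p ≠ ν := by
      refine (Filter.eventually_all_finset _).2 fun ν _ => ?_
      by_cases h : pastLaw P {p | κ p = ν} = 0
      · have : ∀ᵐ p ∂(pastLaw P), κ p ≠ ν := by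
          rw [ae_iff]; simpa using h
        filter_upwards [this] with p hp _ using hp
      · exact Filter.Eventually.of_forall fun p h' => absurd h' h
    filter_upwards [h1, hA] with p hp hpA
    have hm : κ p ∈ hFfin.toFinset := by simpa using ⟨p, hpA, rfl⟩
    exact Finset.mem_filter.2 ⟨hm, fun h => hp _ hm h rfl⟩
  obtain ⟨p₀, hp₀⟩ := hV.exists
  let e := V.equivFin
  let law : Fin V.card → Measure (ℕ → α) := fun i => (e.symm i : Measure (ℕ → α))
  let i₀ : Fin V.card := e ⟨κ p₀, hp₀⟩
  -- `i₀` is a default for the null set of pasts whose conditional future is not in `V`.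
  let state : (ℕ → α) → Fin V.card := fun p => if h : κ p ∈ V then e ⟨κ p, h⟩ else i₀
  have hlaw : ∀ p, κ p ∈ V → law (state p) = κ p := fun p hp => by
    simp [law, state, hp]
  have hinj : Function.Injective law := fun i j h => e.symm.injective (Subtype.ext h)
  have hmem : ∀ i, law i ∈ V := fun i => (e.symm i).2
  have hsub : ∀ i, {p | κ p = law i} ⊆ state ⁻¹' {i} := by
    intro i p hp
    have hpV : κ p ∈ V := by rw [show κ p = law i from hp]; exact hmem i
    exact hinj ((hlaw p hpV).trans hp)
  refine ⟨V.card, ?_, ⟨{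
    state := state
    measurable_state := measurable_to_countable' fun i => ?_
    law := law
    law_injective := hinj
    ae_eq := hV.mono fun p hp => (hlaw p hp).symm
    pos := fun i h => (Finset.mem_filter.1 (hmem i)).2 (measure_mono_null (hsub i) h) }⟩⟩
  · calc ((V.card : ℕ) : ℕ∞) ≤ (hFfin.toFinset.card : ℕ∞) :=
          Nat.cast_le.2 (Finset.card_filter_le _ _)
      _ = (κ '' A).encard := hFfin.encard_eq_coe_toFinset_card.symm
      _ ≤ (causalState P '' A).encard := hF ▸ Set.encard_image_le _ _
  · have hm : ∀ i, MeasurableSet {p | κ p = law i} := fun i =>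
      measurableSet_setOf_kernel_eq κ (law i)
    have hset : state ⁻¹' {i} =
        {p | κ p = law i} ∪ {p | i = i₀ ∧ p ∈ (⋃ j, {p | κ p = law j})ᶜ} := by
      ext p
      refine ⟨fun h => ?_, ?_⟩
      · by_cases hp : κ p ∈ V
        · left
          change κ p = law i
          rw [← hlaw p hp, show state p = i from h]
        · right
          refine ⟨?_, fun hj => ?_⟩
          · rw [← show state p = i from h]; simp [state, hp]
          · obtain ⟨j, hj⟩ := Set.mem_iUnion.1 hj
            exact hp (by rw [show κ p = law j from hj]; exact hmem j)
      · rintro (h | ⟨rfl, h⟩)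
        · exact hsub i h
        · have hp : κ p ∉ V := fun hp => h (Set.mem_iUnion.2 ⟨state p, (hlaw p hp).symm⟩)
          change state p = i₀
          simp [state, hp]
    rw [hset]
    exact (hm i).union ((MeasurableSet.const _).inter (MeasurableSet.iUnion hm).compl)

namespace StateEncoding

variable {P : Measure (ℤ → α)} [IsFiniteMeasure P] {d : ℕ} (S : StateEncoding P d)

lemma measurableSet_state_eq (i : Fin d) : MeasurableSet (S.state ⁻¹' {i}) :=
  S.measurable_state (measurableSet_singleton i)

/-- An almost sure property of pasts holds for some past in each state. -/
lemma exists_state_eq {q : (ℕ → α) → Prop} (hq : ∀ᵐ p ∂(pastLaw P), q p) (i : Fin d) :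
    ∃ p, S.state p = i ∧ q p := by
  by_contra! h
  exact S.pos i (measure_mono_null (fun p hp => h p hp) hq)

instance isProbabilityMeasure_law (i : Fin d) : IsProbabilityMeasure (S.law i) := by
  obtain ⟨p, rfl, hp⟩ := S.exists_state_eq S.ae_eq i
  rw [← hp]
  infer_instance

/-- The ε-machine is unifilar: the current state and the next output determine the next state. -/
lemma exists_successor (hP : IsStationary P) : ∃ next : Fin d → α → Fin d,
    (∀ᵐ p ∂(pastLaw P), ∀ x, conditionalFuture P p {y | y 0 = x} ≠ 0 →
      S.state (extend p x) = next (S.state p) x) ∧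
    ∀ j x B, MeasurableSet B → S.law j {y | y 0 = x ∧ tail y ∈ B} =
      S.law j {y | y 0 = x} * S.law (next j x) B := by
  let E : Fin d → α → Fin d → Set (ℕ → α) :=
    fun j x i => {p | S.state p = j ∧ S.state (extend p x) = i}
  -- The finitely many sets `E j x i` cover state `j`, which has positive probability. The successor
  -- will be any `i` found here; when `x` has probability zero from `j`, the choice is immaterial.
  have hex : ∀ j x, ∃ i, pastLaw P (E j x i) ≠ 0 := by
    intro j x
    by_contra! h
    refine S.pos j (measure_mono_null (fun p hp => ?_) (measure_iUnion_null h))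
    exact Set.mem_iUnion.2 ⟨S.state (extend p x), hp, rfl⟩
  have hE : ∀ j x i, pastLaw P (E j x i) ≠ 0 → ∀ B, MeasurableSet B →
      S.law j {y | y 0 = x ∧ tail y ∈ B} = S.law j {y | y 0 = x} * S.law i B := by
    intro j x i h B hB
    by_cases hT : S.law j {y | y 0 = x} = 0
    · rw [hT, zero_mul]
      exact measure_mono_null (fun y hy => hy.1) hT
    -- A set of positive measure contains a past at which the almost sure update rule holds for this
    -- `B`; the resulting identity involves only `j`, `x` and `i`.
    obtain ⟨p, ⟨rfl, rfl⟩, hp, hpe, hpB⟩ : ∃ p, p ∈ E j x i ∧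
        conditionalFuture P p = S.law (S.state p) ∧
        (∀ x, conditionalFuture P p {y | y 0 = x} ≠ 0 →
          conditionalFuture P (extend p x) = S.law (S.state (extend p x))) ∧
        conditionalFuture P p {y | y 0 = x} * conditionalFuture P (extend p x) B =
          conditionalFuture P p {y | y 0 = x ∧ tail y ∈ B} := by
      by_contra! hc
      refine h (measure_mono_null (fun p hp => ?_) (S.ae_eq.and ((ae_extend hP S.ae_eq).and
        (ae_conditionalFuture_extend hP x hB))))
      exact fun h' => hc p hp h'.1 h'.2.1 h'.2.2
    rw [hp] at hpe
    rw [hp, hpe x hT] at hpB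
    exact hpB.symm
  choose next hnext using hex
  refine ⟨next, ?_, fun j x B hB => hE j x _ (hnext j x) B hB⟩
  have hnull : ∀ᵐ p ∂(pastLaw P), ∀ j x i, pastLaw P (E j x i) = 0 → p ∉ E j x i := by
    simp_rw [ae_all_iff]
    exact fun j x i h => measure_eq_zero_iff_ae_notMem.1 h
  filter_upwards [hnull, S.ae_eq] with p hp hpe x hx
  rw [hpe] at hx
  have h1 : pastLaw P (E (S.state p) x (S.state (extend p x))) ≠ 0 := fun h =>
    hp _ _ _ h ⟨rfl, rfl⟩
  -- Two successors reached with positive probability satisfy the same identity, so cancelling the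
  -- output probability shows that their laws agree.
  refine S.law_injective (Measure.ext fun B hB => ?_)
  have h2 := (hE _ _ _ h1 B hB).symm.trans (hE _ _ _ (hnext (S.state p) x) B hB)
  exact (ENNReal.mul_right_inj hx (measure_ne_top _ _)).1 h2

lemma hasSum_law_head (i : Fin d) : HasSum (fun x => (S.law i).real {y | y 0 = x}) 1 := by
  have h := tsum_measure_preimage_singleton (μ := S.law i) (f := fun y : ℕ → α => y 0)
    (s := Set.univ) Set.countable_univ (fun x _ => measurableSet_head_eq x)
  rw [Set.preimage_univ, measure_univ, tsum_univ (f := fun x =>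
    S.law i ((fun y => y 0) ⁻¹' {x}))] at h
  have h2 := ENNReal.hasSum_toReal (f := fun x => S.law i ((fun y => y 0) ⁻¹' {x}))
    (by rw [h]; exact ENNReal.one_ne_top)
  rw [← ENNReal.tsum_toReal_eq (fun x => measure_ne_top _ _), h] at h2
  exact h2

/-- The measure of a set of pasts in a given state and of futures. -/
lemma measure_state_eq_and_future (j : Fin d) {B : Set (ℕ → α)} (hB : MeasurableSet B) :
    P {ω | S.state (past ω) = j ∧ future ω ∈ B} =
      pastLaw P (S.state ⁻¹' {j}) * S.law j B := by
  have hj := S.measurableSet_state_eq j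
  have h := setLIntegral_conditionalFuture P hj hB
  have h2 : ∫⁻ p in S.state ⁻¹' {j}, conditionalFuture P p B ∂(pastLaw P) =
      ∫⁻ _ in S.state ⁻¹' {j}, S.law j B ∂(pastLaw P) := by
    refine setLIntegral_congr_fun_ae hj ?_
    filter_upwards [S.ae_eq] with p hp hpj
    rw [hp, show S.state p = j from hpj]
  rw [h2, setLIntegral_const, mul_comm] at h
  exact h.symm

end StateEncoding

end States

/-! ### Quantum models of the process and of its reversal. -/

section Models

variable {d : ℕ}

lemma norm_ket (i : Fin d) : ‖(ket i : Qudit d)‖ = 1 := by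
  simp [ket]

lemma inner_ket_ket (i j : Fin d) : inner ℂ (ket i) (ket j) = if i = j then (1 : ℂ) else 0 := by
  simp [ket, EuclideanSpace.inner_single_left]

lemma star_rankOne_mul_rankOne (a b c e : Qudit d) :
    star (InnerProductSpace.rankOne ℂ a b : Op d) * InnerProductSpace.rankOne ℂ c e =
      inner ℂ a c • (InnerProductSpace.rankOne ℂ b e : Op d) := by
  rw [ContinuousLinearMap.star_eq_adjoint, InnerProductSpace.adjoint_rankOne,
    ContinuousLinearMap.mul_def, InnerProductSpace.rankOne_comp_rankOne]

variable {α : Type*} [MeasurableSpace α] [Nonempty α] [Countable α] [MeasurableSingletonClass α]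

lemma outputProb_nonneg (P : Measure (ℤ → α)) [IsFiniteMeasure P] (p : ℕ → α) (x : α) :
    0 ≤ outputProb P p x :=
  measureReal_nonneg

lemma minQuantumDim_le {P : Measure (ℤ → α)} [IsFiniteMeasure P] (Q : QuantumModel P d) :
    minQuantumDim P ≤ d :=
  iInf₂_le d ⟨Q⟩

namespace StateEncoding

variable {P : Measure (ℤ → α)} [IsFiniteMeasure P] (S : StateEncoding P d)

/-- The ε-machine as a quantum model with orthogonal internal states. -/
lemma nonempty_quantumModel (S : StateEncoding P d) (hP : IsStationary P) :
    Nonempty (QuantumModel P d) := by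
  obtain ⟨next, hnext, -⟩ := S.exists_successor hP
  let T : Fin d → α → ℝ := fun j x => (S.law j).real {y | y 0 = x}
  have hT : ∀ j x, ((Real.sqrt (T j x) : ℂ)) * (Real.sqrt (T j x) : ℂ) = (T j x : ℂ) := by
    intro j x
    rw [← Complex.ofReal_mul, Real.mul_self_sqrt measureReal_nonneg]
  -- One Kraus operator per state: `next · x` may merge states, and a single operator summing over
  -- `j` would then have off-diagonal terms in its effect.
  let K : α → Fin d → Op d := fun x j =>
    (Real.sqrt (T j x) : ℂ) • InnerProductSpace.rankOne ℂ (ket (next j x)) (ket j)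
  have hK : ∀ x, ∑ a, star (K x a) * K x a = ∑ j, (T j x : ℂ) • ketbra (ket j) := by
    intro x
    refine Finset.sum_congr rfl fun j _ => ?_
    simp only [K, star_smul, smul_mul_smul_comm, star_rankOne_mul_rankOne, inner_ket_ket, if_true,
      one_smul]
    rw [← hT]
    simp [ketbra]
  let M : QuantumInstrument α d := instrumentOfKraus K T (fun j _ => j) hK fun i => by
    simpa [T] using S.hasSum_law_head i
  have hM : ∀ x i, M.op x (ketbra (ket i)) = (T i x : ℂ) • ketbra (ket (next i x)) := by
    intro x i
    change krausMap (K x) _ = _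
    rw [krausMap_apply]
    simp_rw [mul_ketbra_mul_star]
    rw [Finset.sum_eq_single i]
    · have : K x i (ket i) = (Real.sqrt (T i x) : ℂ) • ket (next i x) := by
        simp only [K, _root_.smul_apply, InnerProductSpace.rankOne_apply,
          inner_ket_ket, if_true, one_smul]
      rw [this, ketbra_smul, Real.sq_sqrt measureReal_nonneg]
    · intro j _ hj
      have : K x j (ket i) = 0 := by
        simp only [K, _root_.smul_apply, InnerProductSpace.rankOne_apply,
          inner_ket_ket, if_neg hj, zero_smul, smul_zero]
      rw [this]
      simp [ketbra]
    · simp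
  have hout : ∀ᵐ p ∂(pastLaw P), ∀ x, outputProb P p x = T (S.state p) x := by
    filter_upwards [S.ae_eq] with p hp x
    rw [outputProb, hp]
  refine ⟨{
    f := fun p => ket (S.state p)
    measurable_f := (measurable_of_countable ket).comp S.measurable_state
    norm_f := fun p => norm_ket _
    M := M
    output := ?_
    transition := ?_ }⟩
  · filter_upwards [hout] with p hp x
    rw [hM, hp]
    have : trace ((T (S.state p) x : ℂ) • ketbra (ket (next (S.state p) x))) =
      (T (S.state p) x : ℂ) * trace (ketbra (ket (next (S.state p) x))) := by
      simp [trace]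
    rw [this, trace_ketbra, norm_ket]
    simp
  · filter_upwards [hout, hnext] with p hp hn x hx
    have hx' : conditionalFuture P p {y | y 0 = x} ≠ 0 := fun h => hx (by
      simp [outputProb, Measure.real, h])
    rw [hM, hn x hx', hp, smul_smul, inv_mul_cancel₀, one_smul]
    rw [hp] at hx
    exact_mod_cast hx

/-- The rates of the retrodictive machine: `P(X₋₁ = x, S₋₁ = j | S₀ = next j x)`. -/
noncomputable def reverseRate (next : Fin d → α → Fin d) (j : Fin d) (x : α) : ENNReal :=
  pastLaw P (S.state ⁻¹' {j}) * S.law j {y | y 0 = x} / pastLaw P (S.state ⁻¹' {next j x})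

lemma reverseRate_ne_top (next : Fin d → α → Fin d) (j : Fin d) (x : α) :
    S.reverseRate next j x ≠ ⊤ :=
  ENNReal.div_ne_top (ENNReal.mul_ne_top (measure_ne_top _ _) (measure_ne_top _ _)) (S.pos _)

variable {next : Fin d → α → Fin d}

/-- By stationarity, the numerators of the rates into `i` with output `x` add up to `P(X₋₁ = x, S₀ =
i)`; summing over `x` leaves `P(S₀ = i)`, the common denominator. -/
lemma tsum_reverseRate (hP : IsStationary P)
    (hnext : ∀ᵐ p ∂(pastLaw P), ∀ x, conditionalFuture P p {y | y 0 = x} ≠ 0 →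
      S.state (extend p x) = next (S.state p) x) (i : Fin d) :
    ∑' x, ∑ j, (if next j x = i then S.reverseRate next j x else 0) = 1 := by
  have hi := S.measurableSet_state_eq i
  have h1 : ∀ x, pastLaw P (S.state ⁻¹' {i} ∩ (fun p => p 0) ⁻¹' {x}) =
      ∑ j, if next j x = i then pastLaw P (S.state ⁻¹' {j}) * S.law j {y | y 0 = x} else 0 := by
    intro x
    have hm : Measurable ((S.state ⁻¹' {i}).indicator (1 : (ℕ → α) → ENNReal)) :=
      measurable_one.indicator hi
    have h := lintegral_head_mul_extend hP x hm
    rw [lintegral_indicator_one hi, Measure.restrict_apply hi] at h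
    refine h.symm.trans ?_
    have h2 : ∀ᵐ p ∂(pastLaw P), conditionalFuture P p {y | y 0 = x} *
        (S.state ⁻¹' {i}).indicator (1 : (ℕ → α) → ENNReal) (extend p x) =
        ∑ j, (S.state ⁻¹' {j}).indicator
          (fun _ => if next j x = i then S.law j {y | y 0 = x} else 0) p := by
      filter_upwards [hnext, S.ae_eq] with p hp hpe
      rw [Finset.sum_eq_single (S.state p)]
      -- For an output of probability zero the successor is not controlled, but both sides vanish.
      · by_cases hT : conditionalFuture P p {y | y 0 = x} = 0
        · rw [hT, zero_mul]
          rw [hpe] at hT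
          simp [hT]
        · simp [Set.indicator, hp x hT, hpe]
      · intro j _ hj
        simp [Set.indicator, hj.symm]
      · simp
    rw [lintegral_congr_ae h2, lintegral_finsetSum _ fun j _ =>
      measurable_const.indicator (S.measurableSet_state_eq j)]
    refine Finset.sum_congr rfl fun j _ => ?_
    rw [lintegral_indicator_const (S.measurableSet_state_eq j)]
    split_ifs
    · rw [mul_comm]
    · rw [zero_mul]
  have h3 : ∑' x, pastLaw P (S.state ⁻¹' {i} ∩ (fun p => p 0) ⁻¹' {x}) =
      pastLaw P (S.state ⁻¹' {i}) := by
    have h := tsum_measure_preimage_singleton (μ := (pastLaw P).restrict (S.state ⁻¹' {i}))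
      (f := fun y : ℕ → α => y 0) (s := Set.univ) Set.countable_univ
      (fun x _ => measurableSet_head_eq x)
    rw [Set.preimage_univ, Measure.restrict_apply_univ, tsum_univ (f := fun x =>
      (pastLaw P).restrict (S.state ⁻¹' {i}) ((fun y => y 0) ⁻¹' {x}))] at h
    rw [← h]
    refine tsum_congr fun x => ?_
    exact (congrArg _ (Set.inter_comm _ _)).trans
      (Measure.restrict_apply (measurableSet_head_eq x)).symm
  have h4 : ∀ x, ∑ j, (if next j x = i then S.reverseRate next j x else 0) =
      pastLaw P (S.state ⁻¹' {i} ∩ (fun p => p 0) ⁻¹' {x}) *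
        (pastLaw P (S.state ⁻¹' {i}))⁻¹ := by
    intro x
    rw [h1, Finset.sum_mul]
    refine Finset.sum_congr rfl fun j _ => ?_
    split_ifs with h
    · rw [reverseRate, h, div_eq_mul_inv]
    · rw [zero_mul]
  simp_rw [h4]
  rw [ENNReal.tsum_mul_right, h3, ENNReal.mul_inv_cancel (S.pos i) (measure_ne_top _ _)]

/-- The conditional probability, given the future, of the last output and the state before it. -/
lemma ae_reverse_state (hP : IsStationary P)
    (hlaw : ∀ j x B, MeasurableSet B → S.law j {y | y 0 = x ∧ tail y ∈ B} =
      S.law j {y | y 0 = x} * S.law (next j x) B) (j : Fin d) (x : α) :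
    ∀ᵐ y ∂(pastLaw (timeReversal P)),
      conditionalFuture (timeReversal P) y {p | p 0 = x ∧ tail p ∈ S.state ⁻¹' {j}} =
        S.reverseRate next j x *
          conditionalFuture (timeReversal P) y (S.state ⁻¹' {next j x}) := by
  have hx := measurableSet_head_eq x
  have hj := S.measurableSet_state_eq j
  have hi := S.measurableSet_state_eq (next j x)
  have hxj : MeasurableSet {p | p 0 = x ∧ tail p ∈ S.state ⁻¹' {j}} :=
    hx.inter (measurable_tail hj)
  have hrev : ∀ {D B : Set (ℕ → α)}, MeasurableSet D → MeasurableSet B →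
      ∫⁻ y in D, conditionalFuture (timeReversal P) y B ∂(pastLaw (timeReversal P)) =
        P {ω | past ω ∈ B ∧ future ω ∈ D} := by
    intro D B hD hB
    have hm : MeasurableSet {ω : ℤ → α | past ω ∈ D ∧ future ω ∈ B} :=
      (measurable_past hD).inter (measurable_future hB)
    rw [setLIntegral_conditionalFuture _ hD hB, timeReversal,
      Measure.map_apply measurable_reverse hm]
    congr 1
    ext ω
    simp only [Set.mem_preimage, Set.mem_ofPred_eq, past_reverse, future_reverse, and_comm]
  refine ae_eq_of_forall_setLIntegral_eq_of_sigmaFinite (Kernel.measurable_coe _ hxj)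
    ((Kernel.measurable_coe _ hi).const_mul _) fun D hD _ => ?_
  rw [lintegral_const_mul _ (Kernel.measurable_coe _ hi), hrev hD hxj, hrev hD hi]
  have hxD : MeasurableSet {y | y 0 = x ∧ tail y ∈ D} := hx.inter (measurable_tail hD)
  have hs : MeasurableSet {ω : ℤ → α |
      past ω ∈ {p | p 0 = x ∧ tail p ∈ S.state ⁻¹' {j}} ∧ future ω ∈ D} :=
    (measurable_past hxj).inter (measurable_future hD)
  -- One shift turns an event about `S₋₁`, `X₋₁` and the future into one about the present state and
  -- the future alone, where unifilarity factors the law.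
  have hpre : shift ⁻¹' {ω : ℤ → α |
      past ω ∈ {p | p 0 = x ∧ tail p ∈ S.state ⁻¹' {j}} ∧ future ω ∈ D} =
      {ω | S.state (past ω) = j ∧ future ω ∈ {y | y 0 = x ∧ tail y ∈ D}} := by
    ext ω
    have h0 : extend (past ω) (ω 0) 0 = ω 0 := rfl
    have h1 : future ω 0 = ω 0 := rfl
    simp only [Set.mem_preimage, Set.mem_ofPred_eq, past_shift, future_shift, tail_extend,
      Set.mem_singleton_iff, h0, h1]
    tauto
  rw [← hP.measure_preimage_shift hs, hpre,
    S.measure_state_eq_and_future j hxD, hlaw j x D hD]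
  refine Eq.trans ?_ (congrArg _ (S.measure_state_eq_and_future (next j x) hD).symm)
  rw [reverseRate, ← mul_assoc, ← mul_assoc, ENNReal.div_mul_cancel (S.pos _) (measure_ne_top _ _)]

/-- The square roots of the conditional probabilities of the state given the future. -/
noncomputable def amplitudes (y : ℕ → α) : Qudit d :=
  WithLp.toLp 2 fun i =>
    (Real.sqrt ((conditionalFuture (timeReversal P) y).real (S.state ⁻¹' {i})) : ℂ)

lemma measurable_amplitudes : Measurable S.amplitudes := by
  refine (MeasurableEquiv.toLp 2 (Fin d → ℂ)).measurable.comp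
    (measurable_pi_lambda _ fun i => ?_)
  exact Complex.measurable_ofReal.comp
    (Kernel.measurable_coe _ (S.measurableSet_state_eq i)).ennreal_toReal.sqrt

lemma norm_amplitudes (y : ℕ → α) : ‖S.amplitudes y‖ = 1 := by
  have h : ∑ i, (conditionalFuture (timeReversal P) y).real (S.state ⁻¹' {i}) = 1 := by
    rw [sum_measureReal_preimage_singleton _ fun i _ => S.measurableSet_state_eq i]
    simp
  rw [EuclideanSpace.norm_eq, Real.sqrt_eq_one, ← h]
  refine Finset.sum_congr rfl fun i _ => ?_
  simp only [amplitudes, Complex.norm_real, Real.norm_eq_abs, sq_abs]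
  exact Real.sq_sqrt measureReal_nonneg

/-- The square roots of the conditional probabilities of the causal states given the future are
the internal states of a quantum model of the time-reversed process. -/
lemma nonempty_quantumModel_timeReversal (S : StateEncoding P d) (hP : IsStationary P) :
    Nonempty (QuantumModel (timeReversal P) d) := by
  obtain ⟨next, hnext, hlaw⟩ := S.exists_successor hP
  let w : Fin d → α → ℝ := fun j x => (S.reverseRate next j x).toReal
  have hw0 : ∀ j x, 0 ≤ w j x := fun _ _ => ENNReal.toReal_nonneg
  -- Here one coherent operator per output works: the target vectors `ket j` are orthogonal, so the
  -- effect is diagonal even when `next · x` merges states.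
  let K : α → Unit → Op d := fun x _ =>
    ∑ j, (Real.sqrt (w j x) : ℂ) • (InnerProductSpace.rankOne ℂ (ket j) (ket (next j x)) : Op d)
  have hK : ∀ x, ∑ a, star (K x a) * K x a = ∑ j, (w j x : ℂ) • ketbra (ket (next j x)) := by
    intro x
    rw [Fintype.sum_unique]
    have hstar : ∀ A : Fin d → Op d, star (∑ j, A j) = ∑ j, star (A j) := fun A =>
      star_sum (R := Op d) Finset.univ A
    simp only [K]
    rw [hstar, Finset.sum_mul_sum]
    refine Finset.sum_congr rfl fun j _ => ?_
    simp only [star_smul, smul_mul_smul_comm, star_rankOne_mul_rankOne, inner_ket_ket]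
    rw [Finset.sum_eq_single j]
    · have : (Real.sqrt (w j x) : ℂ) * (Real.sqrt (w j x) : ℂ) = (w j x : ℂ) := by
        rw [← Complex.ofReal_mul, Real.mul_self_sqrt (hw0 j x)]
      rw [← this]
      simp [ketbra]
    · intro b _ hb
      rw [if_neg hb.symm, zero_smul]
      exact smul_zero (M := ℂ) (A := Op d) _
    · simp
  let M : QuantumInstrument α d := instrumentOfKraus K w next hK fun i => by
    have h := S.tsum_reverseRate hP hnext i
    have hne : ∀ x, ∑ j, (if next j x = i then S.reverseRate next j x else 0) ≠ ⊤ := fun x =>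
      ENNReal.ne_top_of_tsum_ne_top (by rw [h]; exact ENNReal.one_ne_top) x
    have h2 := ENNReal.hasSum_toReal (f := fun x =>
      ∑ j, (if next j x = i then S.reverseRate next j x else 0))
      (by rw [h]; exact ENNReal.one_ne_top)
    rw [← ENNReal.tsum_toReal_eq hne, h, ENNReal.toReal_one] at h2
    convert h2 using 2 with x
    rw [ENNReal.toReal_sum]
    · refine Finset.sum_congr rfl fun j _ => ?_
      split_ifs <;> rfl
    · intro j _
      split_ifs
      · exact S.reverseRate_ne_top next j x
      · exact ENNReal.zero_ne_top
  have hKf : ∀ᵐ y ∂(pastLaw (timeReversal P)), ∀ x, K x () (S.amplitudes y) =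
      (Real.sqrt (outputProb (timeReversal P) y x) : ℂ) • S.amplitudes (extend y x) := by
    have h1 : ∀ᵐ y ∂(pastLaw (timeReversal P)), ∀ j x,
        conditionalFuture (timeReversal P) y {p | p 0 = x ∧ tail p ∈ S.state ⁻¹' {j}} =
          S.reverseRate next j x *
            conditionalFuture (timeReversal P) y (S.state ⁻¹' {next j x}) := by
      simp_rw [ae_all_iff]
      exact fun j x => S.ae_reverse_state hP hlaw j x
    have h2 : ∀ᵐ y ∂(pastLaw (timeReversal P)), ∀ j x,
        conditionalFuture (timeReversal P) y {p | p 0 = x} *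
          conditionalFuture (timeReversal P) (extend y x) (S.state ⁻¹' {j}) =
        conditionalFuture (timeReversal P) y {p | p 0 = x ∧ tail p ∈ S.state ⁻¹' {j}} := by
      simp_rw [ae_all_iff]
      exact fun j x => ae_conditionalFuture_extend hP.timeReversal x (S.measurableSet_state_eq j)
    filter_upwards [h1, h2] with y hy1 hy2 x
    ext j
    -- Chain rule and retrodiction compute the same joint probability; the square root of this
    -- identity is coordinate `j` of the claim.
    have h3 := congrArg ENNReal.toReal ((hy2 j x).trans (hy1 j x))
    rw [ENNReal.toReal_mul, ENNReal.toReal_mul] at h3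
    have h4 : (K x () (S.amplitudes y)) j =
        (Real.sqrt (w j x) : ℂ) * S.amplitudes y (next j x) := by
      have hket : ∀ i, inner ℂ (ket i) (S.amplitudes y) = S.amplitudes y i := fun i => by
        simp [ket, EuclideanSpace.inner_single_left]
      simp only [K, _root_.sum_apply, _root_.smul_apply,
        InnerProductSpace.rankOne_apply, hket, WithLp.ofLp_sum, Finset.sum_apply]
      rw [Finset.sum_eq_single j]
      · simp [ket]
      · intro b _ hb
        simp [ket, hb.symm]
      · simp
    rw [h4]
    simp only [amplitudes, PiLp.smul_apply, smul_eq_mul]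
    rw [← Complex.ofReal_mul, ← Complex.ofReal_mul, ← Real.sqrt_mul (hw0 j x),
      ← Real.sqrt_mul (outputProb_nonneg _ _ _)]
    congr 2
    exact h3.symm
  have hM : ∀ᵐ y ∂(pastLaw (timeReversal P)), ∀ x, M.op x (ketbra (S.amplitudes y)) =
      (outputProb (timeReversal P) y x : ℂ) • ketbra (S.amplitudes (extend y x)) := by
    filter_upwards [hKf] with y hy x
    change krausMap (K x) _ = _
    rw [krausMap_apply]
    simp only [Finset.univ_unique, Finset.sum_singleton, mul_ketbra_mul_star]
    rw [show (default : Unit) = () from rfl, hy x, ketbra_smul,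
      Real.sq_sqrt (outputProb_nonneg _ _ _)]
  refine ⟨{
    f := S.amplitudes
    measurable_f := S.measurable_amplitudes
    norm_f := S.norm_amplitudes
    M := M
    output := ?_
    transition := ?_ }⟩
  · filter_upwards [hM] with y hy x
    have : trace ((outputProb (timeReversal P) y x : ℂ) • ketbra (S.amplitudes (extend y x))) =
        (outputProb (timeReversal P) y x : ℂ) * trace (ketbra (S.amplitudes (extend y x))) := by
      simp [trace]
    rw [hy x, this, trace_ketbra, S.norm_amplitudes]
    simp
  · filter_upwards [hM] with y hy x hx
    rw [hy x, smul_smul, inv_mul_cancel₀ (by exact_mod_cast hx), one_smul]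

end StateEncoding

lemma minQuantumDim_le_numCausalStates {P : Measure (ℤ → α)} [IsProbabilityMeasure P]
    (hP : IsStationary P) :
    max (minQuantumDim P) (minQuantumDim (timeReversal P)) ≤ numCausalStates P := by
  refine le_iInf₂ fun A hA => ?_
  by_cases hfin : (causalState P '' A).Finite
  · obtain ⟨d, hd, ⟨S⟩⟩ := exists_stateEncoding P hA hfin
    obtain ⟨Q⟩ := S.nonempty_quantumModel hP
    obtain ⟨Q'⟩ := S.nonempty_quantumModel_timeReversal hP
    exact (max_le (minQuantumDim_le Q) (minQuantumDim_le Q')).trans hd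
  · rw [Set.encard_eq_top_iff.2 hfin]
    exact le_top

lemma max_quantumTopologicalComplexity_le {P : Measure (ℤ → α)} [IsProbabilityMeasure P]
    (hP : IsStationary P) :
    max (quantumTopologicalComplexity P) (quantumTopologicalComplexity (timeReversal P)) ≤
      classicalTopologicalComplexity P := by
  have h := max_le_iff.1 (minQuantumDim_le_numCausalStates hP)
  exact max_le (ENNReal.log_monotone (ENat.toENNReal_mono h.1))
    (ENNReal.log_monotone (ENat.toENNReal_mono h.2))

end Models

end CausalAsymmetry

theorem mainTheorem4 {α : Type*} [MeasurableSpace α] [Nonempty α] [Countable α]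
    [MeasurableSingletonClass α] (P : MeasureTheory.Measure (ℤ → α))
    [MeasureTheory.IsProbabilityMeasure P] (hP : CausalAsymmetry.IsStationary P) :
    max (CausalAsymmetry.quantumTopologicalComplexity P)
        (CausalAsymmetry.quantumTopologicalComplexity (CausalAsymmetry.timeReversal P)) ≤
      min (CausalAsymmetry.classicalTopologicalComplexity P)
        (CausalAsymmetry.classicalTopologicalComplexity (CausalAsymmetry.timeReversal P)) := by
  refine le_min (CausalAsymmetry.max_quantumTopologicalComplexity_le hP) ?_
  have h := CausalAsymmetry.max_quantumTopologicalComplexity_le hP.timeReversal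
  simp only [CausalAsymmetry.timeReversal_timeReversal] at h
  rwa [max_comm] at h
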